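/- Let $I$ be a (possibly uncountable) set of agents. For each $i\in I$ let $X_i$ be a non-empty compact convex subset of a real locally convex space $E_i$, put $X=\prod_{i\in I}X_i$, and let $A_i,B_i,P_i:X\to 2^{X_i}$ be correspondences (closures are taken in $X_i$ and in $X$ with their subspace topologies). Assume that for each $i\in I$: (1) the correspondence $x\mapsto \operatorname{cl}B_i(x)$ is upper semicontinuous on $X$ with non-empty convex values, and $A_i(x)\subset B_i(x)$ for all $x\in X$; (2) the set $W_i=\{x\in X: A_i(x)\cap P_i(x)\neq\emptyset\}$ is non-empty and open in $X$, and its closure $K_i=\operatorname{cl}W_i$ in $X$ is a (finite-dimensional) simplex, that is, the convex hull of finitely many affinely independent points; (3) for every convex neighbourhood $V$ of $0$ in $E_i$, the correspondence $x\mapsto (A_i(x)+V)\cap P_i(x)$ is weakly naturally quasi-concave on $K_i$; (4) $x_i\notin P_i(x)$ for all $x\in K_i$. Then there is an equilibrium: a point $\bar x\in X$ such that for each $i\in I$, $\bar x_i\in\overline{B}_i(\bar x)$ and $A_i(\bar x)\cap P_i(\bar x)=\emptyset$, where $\overline{B}_i(x)=\{y\in X_i:(x,y)\in\operatorname{cl}_{X\times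 X_i}\operatorname{Gr}B_i\}$. Here a correspondence $T:K\to 2^{Y}$ on a non-empty convex set $K$ is weakly naturally quasi-concave if for each $n$ and each finite set $\{x_1,\dots,x_n\}\subset K$ there exist $y_k\in T(x_k)$ and continuous functions $g_k:[0,1]\to[0,1]$ with $g_k(0)=0$, $g_k(1)=1$ $(k=1,\dots,n)$, such that $(\lambda_1,\dots,\lambda_n)\mapsto(g_1(\lambda_1),\dots,g_n(\lambda_n))$ maps the standard simplex $\Delta_{n-1}$ into itself and $\sum_{k=1}^n g_k(\lambda_k)y_k\in T\big(\sum_{k=1}^n\lambda_kx_k\big)$ for every $(\lambda_1,\dots,\lambda_n)\in\Delta_{n-1}$. -/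

import Mathlib

open Set Topology
open scoped Pointwise

/-- Let `D` be a subset of a real vector space `F`, let `Y` be a subset of a real vector space `G`
and let `T : D → 2^Y` be a correspondence. `T` is weakly naturally quasi-concave on `K ⊆ D` if for
every finite set `{x₁, …, xₙ}` of (distinct) points of `K` there are `y_k ∈ T(x_k)` and continuous
functions `g_k` on `[0,1]` with `g_k(0) = 0` and `g_k(1) = 1`, such that
`(l₁, …, lₙ) ↦ (g₁(l₁), …, gₙ(lₙ))` maps the standard simplex to itself and, for all `l` in the
standard simplex, `∑ g_k(l_k) y_k ∈ T(∑ l_k x_k)`. -/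
def WeaklyNaturallyQuasiConcaveOn {F G : Type*} [AddCommGroup F] [Module ℝ F]
    [AddCommGroup G] [Module ℝ G] {D : Set F} {Y : Set G} (T : D → Set Y) (K : Set D) : Prop :=
  ∀ (n : ℕ) (x : Fin n → D), Function.Injective x → (∀ k, x k ∈ K) →
    ∃ y : Fin n → Y, (∀ k, y k ∈ T (x k)) ∧
      ∃ g : Fin n → ℝ → ℝ,
        (∀ k, ContinuousOn (g k) (Icc 0 1) ∧ g k 1 = 1 ∧ g k 0 = 0) ∧
        ∀ l ∈ stdSimplex ℝ (Fin n),
          (fun k => g k (l k)) ∈ stdSimplex ℝ (Fin n) ∧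
          ∃ z ∈ K, (z : F) = ∑ k, l k • (x k : F) ∧
            ∃ w ∈ T z, (w : G) = ∑ k, g k (l k) • (y k : G)

/-- An abstract economy with set of agents `I`: for each agent `i` an action set `X i` in the
space `E i`, constraint correspondences `A i`, `B i` and a preference correspondence `P i`, all of
them from the product of the action sets to the subsets of `X i`. -/
structure AbstractEconomy {I : Type*} (E : I → Type*) where
  /-- The action sets. -/
  X : ∀ i, Set (E i)
  /-- The first constraint correspondences. -/
  A : ∀ i, ↥(Set.univ.pi X) → Set (X i)
  /-- The second constraint correspondences. -/
  B : ∀ i, ↥(Set.univ.pi X) → Set (X i)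
  /-- The preference correspondences. -/
  P : ∀ i, ↥(Set.univ.pi X) → Set (X i)

namespace AbstractEconomy

variable {I : Type*} {E : I → Type*} (Γ : AbstractEconomy E)

/-- The product `∏ i, X i` of the action sets, as a subset of `∏ i, E i`. In the topological
notions below its coercion to a type carries the subspace topology. -/
abbrev prodX : Set (∀ i, E i) := Set.univ.pi Γ.X

/-- The `i`-th coordinate of a point of the product, as a point of `X i`. -/
def coord (x : Γ.prodX) (i : I) : Γ.X i := ⟨x.1 i, x.2 i (Set.mem_univ i)⟩

/-- The set of all `x` with `A i x ∩ P i x ≠ ∅`. -/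
def W (i : I) : Set Γ.prodX := {x | (Γ.A i x ∩ Γ.P i x).Nonempty}

/-- The correspondence `x ↦ (A i x + V) ∩ P i x`, for a subset `V` of `E i`. -/
def approx [∀ i, AddCommGroup (E i)] (i : I) (V : Set (E i)) (x : Γ.prodX) : Set (Γ.X i) :=
  {y | (y : E i) ∈ ((↑) '' Γ.A i x : Set (E i)) + V ∧ y ∈ Γ.P i x}

variable [∀ i, TopologicalSpace (E i)]

/-- The correspondence `B̄ i`: its graph is the closure of the graph of `B i` in the product of
`∏ i, X i` and `X i`. -/
def Bbar (i : I) (x : Γ.prodX) : Set (Γ.X i) :=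
  {y | (x, y) ∈ closure {p : Γ.prodX × Γ.X i | p.2 ∈ Γ.B i p.1}}

/-- `x` is an equilibrium: `x i ∈ B̄ i x` and `A i x ∩ P i x = ∅` for every agent `i`. -/
def IsEquilibrium (x : Γ.prodX) : Prop :=
  ∀ i, Γ.coord x i ∈ Γ.Bbar i x ∧ Γ.A i x ∩ Γ.P i x = ∅

end AbstractEconomy

/-!
The equilibrium is a limit of approximate equilibria, which come from Kakutani's theorem.

*Reduction to finite dimension.* `Γ.W i` is nonempty and open in the product and lies in a simplex.
Moving a point of it a little in any coordinate direction stays in the affine span of that simplex,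
and no `Γ.X j` is a single point because `x j ∉ P j x` on `Γ.W j`. Hence there are only finitely many
agents (`finite_of_isOpen_of_subset_affineSubspace`).

*Approximate equilibria.* Fix closed convex neighbourhoods `V i` of `0`. Weak natural quasi-concavity
at the vertices of the simplex `closure (Γ.W i)` gives a selection `f i` of `(A i + V i) ∩ P i`,
continuous in barycentric coordinates (`AbstractEconomy.exists_selection`). The correspondence with
components `{f i x}` for `x ∈ Γ.W i` and `closure (B i x) + V i` elsewhere has a closed graph, because
`f i x ∈ closure (B i x) + V i` on `closure (Γ.W i)`. At a fixed point `x` no `x ∈ Γ.W i` is possible,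
since then `x i = f i x ∈ P i x`; so `x ∉ Γ.W i` and `x i ∈ closure (B i x) + V i` for all `i`
(`AbstractEconomy.exists_approximate_equilibrium`). The sets of these `x` are closed and decrease
with the `V i`, so compactness gives an `x` common to all of them, and this is an equilibrium.

The spaces `E i` need not be Hausdorff. Therefore the fixed point is not sought in the product itself
but in the standard simplex over the vertices of a product of polytopes inside the `Γ.X i` that is
fine enough relative to the `V i`; all equations between points are pulled back there, where kernels
of linear maps are closed (`isClosed_setOf_linearMap_eq`).

*Kakutani's theorem* for the standard simplex (`exists_mem_of_isClosed_graph`) follows from Brouwer's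
theorem by averaging values with a partition of unity. *Brouwer's theorem*
(`exists_fixedPoint_stdSimplex`) is derived from Scarf's combinatorial lemma
(`exists_isPrimitive_image_eq_univ`), a parity argument like the one for Sperner's lemma but with
finitely many rankings in place of a triangulation: colour a grid point `x` by an `i` with
`x i ≤ f x i`. A primitive set of all colours is small up to its slack elements, and these stand for
coordinates that nearly vanish, so that `x i ≤ f x i + ε` holds for every `i` at any of its points.
-/

/-! ### Scarf's lemma on primitive sets -/

section Scarf

variable {T ι : Type*} [Fintype ι]

/-- For a family of rankings `u i : T → ℤ` of a set `T`, a set `σ` of `card ι` elements is primitive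
if no element of `T` beats the `u i`-smallest element of `σ` for every `i`. -/
def IsPrimitive (u : ι → T → ℤ) (σ : Finset T) : Prop :=
  σ.card = Fintype.card ι ∧ ∀ y, ∃ i, ∀ x ∈ σ, u i y ≤ u i x

variable [DecidableEq T]

/-- The elements of a primitive set are exactly its minima for the different rankings. -/
lemma IsPrimitive.exists_min [Nonempty ι] {u : ι → T → ℤ} {σ : Finset T} (h : IsPrimitive u σ)
    (hu : ∀ i, Function.Injective (u i)) :
    ∃ m : ι → T, Function.Injective m ∧ Finset.univ.image m = σ ∧
      ∀ i, ∀ x ∈ σ, u i (m i) ≤ u i x := by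
  have hne : σ.Nonempty := by
    rw [← Finset.card_pos, h.1]; exact Fintype.card_pos
  choose m hm hmin using fun i => σ.exists_min_image (u i) hne
  have himg : Finset.univ.image m = σ := by
    apply Finset.Subset.antisymm
    · intro x hx
      obtain ⟨i, -, rfl⟩ := Finset.mem_image.1 hx
      exact hm i
    · intro x hx
      obtain ⟨i, hi⟩ := h.2 x
      exact Finset.mem_image.2
        ⟨i, Finset.mem_univ i, hu i (le_antisymm (hmin i x hx) (hi _ (hm i)))⟩
  refine ⟨m, ?_, himg, hmin⟩
  have : (Finset.univ.image m).card = (Finset.univ : Finset ι).card := by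
    rw [himg, h.1, Finset.card_univ]
  simpa using Finset.card_image_iff.1 this

variable [DecidableEq ι]

/-- If `σ` has `card ι` elements but misses some colour, then an even number (in fact `0` or `2`) of
its facets carry exactly the colours different from `i₀`. -/
lemma even_card_facets {σ : Finset T} (hσ : σ.card = Fintype.card ι) (c : T → ι) (i₀ : ι)
    (hc : σ.image c ≠ Finset.univ) :
    Even (σ.filter fun x => (σ.erase x).image c = Finset.univ.erase i₀).card := by
  rcases Finset.eq_empty_or_nonempty
    (σ.filter fun x => (σ.erase x).image c = Finset.univ.erase i₀) with h0 | ⟨x₁, hx₁⟩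
  · simp [h0]
  have inj : ∀ x ∈ σ, (σ.erase x).image c = Finset.univ.erase i₀ → InjOn c (σ.erase x) := by
    intro x hx h
    apply Finset.card_image_iff.1
    rw [h, Finset.card_erase_of_mem hx, Finset.card_erase_of_mem (Finset.mem_univ _), hσ,
      Finset.card_univ]
  obtain ⟨h1, h1c⟩ := Finset.mem_filter.1 hx₁
  have hcx : c x₁ ∈ Finset.univ.erase i₀ := by
    refine Finset.mem_erase.2 ⟨fun h => hc ?_, Finset.mem_univ _⟩
    rw [← Finset.insert_erase h1, Finset.image_insert, h1c, h,
      Finset.insert_erase (Finset.mem_univ _)]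
  rw [← h1c] at hcx
  obtain ⟨x₂, hx₂, hcc⟩ := Finset.mem_image.1 hcx
  obtain ⟨hne, h2⟩ := Finset.mem_erase.1 hx₂
  suffices (σ.filter fun x => (σ.erase x).image c = Finset.univ.erase i₀) = {x₁, x₂} by
    rw [this, Finset.card_pair hne.symm]; exact even_two
  ext x
  simp only [Finset.mem_filter, Finset.mem_insert, Finset.mem_singleton]
  constructor
  · rintro ⟨hx, hxc⟩
    by_contra! hcon
    exact hne (inj x hx hxc (Finset.mem_coe.2 (Finset.mem_erase.2 ⟨hcon.2.symm, h2⟩))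
      (Finset.mem_coe.2 (Finset.mem_erase.2 ⟨hcon.1.symm, h1⟩)) hcc)
  · rintro (rfl | rfl)
    · exact ⟨h1, h1c⟩
    · refine ⟨h2, ?_⟩
      rw [← h1c]
      ext j
      simp only [Finset.mem_image, Finset.mem_erase]
      constructor
      · rintro ⟨z, ⟨hz, hzσ⟩, rfl⟩
        by_cases hz1 : z = x₁
        · exact ⟨x, ⟨hne, h2⟩, by rw [hcc, hz1]⟩
        · exact ⟨z, ⟨hz1, hzσ⟩, rfl⟩
      · rintro ⟨z, ⟨hz, hzσ⟩, rfl⟩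
        by_cases hz1 : z = x
        · exact ⟨x₁, ⟨hne.symm, h1⟩, by rw [← hcc, hz1]⟩
        · exact ⟨z, ⟨hz1, hzσ⟩, rfl⟩

/-- Let `m i` be the `u i`-smallest element of the finite set `τ`, and let `i₁ ≠ i₂` be indices with
`m i₁ = m i₂`. The elements that complete `τ` to a primitive set are, for `k = i₁` and `k = i₂`, the
`u k`-largest among those which beat `m i` for all `i ≠ k`. -/
lemma isPrimitive_insert_iff [Nonempty ι] {u : ι → T → ℤ} (hu : ∀ i, Function.Injective (u i))
    {τ : Finset T} {m : ι → T} (hτ : τ.card + 1 = Fintype.card ι)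
    (hm : Finset.univ.image m = τ) (hmin : ∀ i, ∀ x ∈ τ, u i (m i) ≤ u i x)
    (hdom : ∀ y, ∃ i, u i y ≤ u i (m i)) {i₁ i₂ : ι} (hi : i₁ ≠ i₂) (hmi : m i₁ = m i₂) (x : T) :
    (x ∉ τ ∧ IsPrimitive u (insert x τ)) ↔
      ∃ k, (k = i₁ ∨ k = i₂) ∧ (∀ i ≠ k, u i (m i) < u i x) ∧
        ∀ y, (∀ i ≠ k, u i (m i) < u i y) → u k y ≤ u k x := by
  have mem : ∀ i, m i ∈ τ := fun i => hm ▸ Finset.mem_image_of_mem m (Finset.mem_univ i)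
  constructor
  · rintro ⟨hx, hp⟩
    obtain ⟨m', inj', img', min'⟩ := hp.exists_min hu
    obtain ⟨k, -, hk⟩ := Finset.mem_image.1 (img'.symm ▸ Finset.mem_insert_self x τ)
    have hm'τ : ∀ i ≠ k, m' i ∈ τ := by
      intro i hik
      have := img' ▸ Finset.mem_image_of_mem m' (Finset.mem_univ i)
      rcases Finset.mem_insert.1 this with h | h
      · exact absurd (inj' (h.trans hk.symm)) hik
      · exact h
    have hmm : ∀ i ≠ k, m' i = m i := fun i hik =>
      hu i (le_antisymm (min' i _ (Finset.mem_insert_of_mem (mem i))) (hmin i _ (hm'τ i hik)))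
    refine ⟨k, ?_, ?_, ?_⟩
    · by_contra! hcon
      exact hi (inj' (by rw [hmm _ hcon.1.symm, hmm _ hcon.2.symm, hmi]))
    · intro i hik
      refine lt_of_le_of_ne ?_ fun h => hx (hu i h ▸ mem i)
      rw [← hmm i hik]
      exact min' i x (Finset.mem_insert_self x τ)
    · intro y hy
      obtain ⟨i, h⟩ := hp.2 y
      by_cases hik : i = k
      · subst hik
        exact h x (Finset.mem_insert_self x τ)
      · exact absurd (h (m i) (Finset.mem_insert_of_mem (mem i))) (not_le.2 (hy i hik))
  · rintro ⟨k, hk, hx, hmax⟩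
    have hxτ : x ∉ τ := by
      intro h
      obtain ⟨j, -, rfl⟩ := Finset.mem_image.1 (hm.symm ▸ h)
      by_cases hjk : j = k
      · subst hjk
        rcases hk with rfl | rfl
        · exact (hx i₂ hi.symm).ne (by rw [hmi])
        · exact (hx i₁ hi).ne (by rw [hmi])
      · exact (hx j hjk).ne rfl
    refine ⟨hxτ, by rw [Finset.card_insert_of_notMem hxτ, hτ], fun y => ?_⟩
    by_cases hy : ∀ i ≠ k, u i (m i) < u i y
    · refine ⟨k, fun z hz => ?_⟩
      rcases Finset.mem_insert.1 hz with rfl | hz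
      · exact hmax y hy
      · obtain ⟨i, hiy⟩ := hdom y
        by_cases hik : i = k
        · subst hik
          exact hiy.trans (hmin i z hz)
        · exact absurd hiy (not_le.2 (hy i hik))
    · push Not at hy
      obtain ⟨i, hik, hiy⟩ := hy
      refine ⟨i, fun z hz => ?_⟩
      rcases Finset.mem_insert.1 hz with rfl | hz
      · exact hiy.trans (hx i hik).le
      · exact hiy.trans (hmin i z hz)

variable [Fintype T]

open Classical in
/-- A facet of a primitive set is a facet of exactly two primitive sets, unless it consists of the
slack elements `s j`, `j ≠ i`, for some `i`. -/
lemma card_isPrimitive_insert [Nonempty ι] {u : ι → T → ℤ} (hu : ∀ i, Function.Injective (u i))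
    {s : ι → T} (hmin : ∀ i t, u i (s i) ≤ u i t)
    (htop : ∀ i j t, t ∉ range s → j ≠ i → u i t < u i (s j)) (hs : ∃ t, t ∉ range s)
    {τ : Finset T} (hτs : ∀ i, τ ≠ (Finset.univ.erase i).image s) {x₀ : T} (hx₀ : x₀ ∉ τ)
    (hp₀ : IsPrimitive u (insert x₀ τ)) :
    (Finset.univ.filter fun x => x ∉ τ ∧ IsPrimitive u (insert x τ)).card = 2 := by
  have hcard : τ.card + 1 = Fintype.card ι := by
    rw [← hp₀.1, Finset.card_insert_of_notMem hx₀]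
  obtain ⟨t₀, ht₀⟩ := hs
  have hsne : ∀ i j, j ≠ i → s j ≠ s i := fun i j hji h =>
    (lt_of_le_of_lt (hmin i t₀) (htop i j t₀ ht₀ hji)).ne (by rw [h])
  have hτne : τ.Nonempty := by
    rw [Finset.nonempty_iff_ne_empty]
    rintro rfl
    have h1 : Fintype.card ι = 1 := by simpa using hcard.symm
    obtain ⟨i, hi⟩ := Fintype.card_eq_one_iff.1 h1
    apply hτs i
    symm
    simp only [Finset.image_eq_empty]
    ext j
    simp [hi j]
  choose m hmτ hmmin using fun i => τ.exists_min_image (u i) hτne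
  obtain ⟨m', inj', img', min'⟩ := hp₀.exists_min hu
  obtain ⟨k₀, -, hk₀⟩ := Finset.mem_image.1 (img'.symm ▸ Finset.mem_insert_self x₀ τ)
  have hmm : ∀ i ≠ k₀, m' i ∈ τ := by
    intro i hik
    have := img' ▸ Finset.mem_image_of_mem m' (Finset.mem_univ i)
    rcases Finset.mem_insert.1 this with h | h
    · exact absurd (inj' (h.trans hk₀.symm)) hik
    · exact h
  have hmeq : ∀ i ≠ k₀, m' i = m i := fun i hik =>
    hu i (le_antisymm (min' i _ (Finset.mem_insert_of_mem (hmτ i))) (hmmin i _ (hmm i hik)))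
  have hτ_iff : ∀ x ∈ τ, ∃ i ≠ k₀, m i = x := by
    intro x hx
    obtain ⟨i, -, hi⟩ := Finset.mem_image.1 (img'.symm ▸ Finset.mem_insert_of_mem hx)
    have hik : i ≠ k₀ := by
      rintro rfl
      exact hx₀ (by rw [← hk₀, hi]; exact hx)
    exact ⟨i, hik, by rw [← hmeq i hik, hi]⟩
  obtain ⟨k₁, hk, hmk⟩ := hτ_iff (m k₀) (hmτ k₀)
  have himg : Finset.univ.image m = τ := by
    ext x
    simp only [Finset.mem_image, Finset.mem_univ, true_and]
    constructor
    · rintro ⟨i, rfl⟩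
      exact hmτ i
    · intro hx
      obtain ⟨i, -, hi⟩ := hτ_iff x hx
      exact ⟨i, hi⟩
  have hdom : ∀ y, ∃ i, u i y ≤ u i (m i) := fun y =>
    (hp₀.2 y).imp fun i h => h _ (Finset.mem_insert_of_mem (hmτ i))
  -- For each `k` the slack element `s k` beats `m i` for all `i ≠ k`, so a largest such element
  -- exists.
  have hex : ∀ k, ∃ x, (∀ i ≠ k, u i (m i) < u i x) ∧
      ∀ y, (∀ i ≠ k, u i (m i) < u i y) → u k y ≤ u k x := by
    intro k
    have hsk : ∀ i ≠ k, u i (m i) < u i (s k) := by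
      by_contra! hcon
      obtain ⟨i, hik, hle⟩ := hcon
      apply hτs i
      apply Finset.eq_of_subset_of_card_le
      · intro x hx
        have hx' : u i (s k) ≤ u i x := hle.trans (hmmin i x hx)
        have hxr : x ∈ range s := by
          by_contra hxr
          exact absurd hx' (not_le.2 (htop i k x hxr hik.symm))
        obtain ⟨j, rfl⟩ := hxr
        refine Finset.mem_image_of_mem s (Finset.mem_erase.2 ⟨?_, Finset.mem_univ _⟩)
        rintro rfl
        exact absurd ((htop j k t₀ ht₀ hik.symm).trans_le hx') (not_lt.2 (hmin j t₀))
      · refine Finset.card_image_le.trans ?_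
        rw [Finset.card_erase_of_mem (Finset.mem_univ _), Finset.card_univ]
        omega
    obtain ⟨x, hx, hxmax⟩ :=
      (Finset.univ.filter fun y => ∀ i ≠ k, u i (m i) < u i y).exists_max_image (u k)
        ⟨s k, by simpa using hsk⟩
    exact ⟨x, by simpa using hx, fun y hy => hxmax y (by simpa using hy)⟩
  obtain ⟨x₁, hx₁, hmax₁⟩ := hex k₀
  obtain ⟨x₂, hx₂, hmax₂⟩ := hex k₁
  have hx12 : x₁ ≠ x₂ := by
    rintro rfl
    obtain ⟨i, hi⟩ := hdom x₁
    by_cases hik : i = k₀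
    · exact absurd hi (not_le.2 (hx₂ i (by rw [hik]; exact hk.symm)))
    · exact absurd hi (not_le.2 (hx₁ i hik))
  rw [Finset.card_eq_two]
  refine ⟨x₁, x₂, hx12, ?_⟩
  ext x
  simp only [Finset.mem_filter, Finset.mem_univ, true_and, Finset.mem_insert,
    Finset.mem_singleton]
  rw [isPrimitive_insert_iff hu hcard himg hmmin hdom hk.symm hmk.symm]
  constructor
  · rintro ⟨k, rfl | rfl, hx, hxm⟩
    · exact Or.inl (hu k (le_antisymm (hmax₁ x hx) (hxm x₁ hx₁)))
    · exact Or.inr (hu k (le_antisymm (hmax₂ x hx) (hxm x₂ hx₂)))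
  · rintro (rfl | rfl)
    · exact ⟨k₀, Or.inl rfl, hx₁, hmax₁⟩
    · exact ⟨k₁, Or.inr rfl, hx₂, hmax₂⟩

open Classical in
/-- The set of all slack elements but `s i₀` is a facet of exactly one primitive set: it is completed
by the `u i₀`-largest of the remaining elements only. -/
lemma card_isPrimitive_insert_slack {u : ι → T → ℤ} (hu : ∀ i, Function.Injective (u i))
    {s : ι → T} (hmin : ∀ i t, u i (s i) ≤ u i t)
    (htop : ∀ i j t, t ∉ range s → j ≠ i → u i t < u i (s j)) (hs : ∃ t, t ∉ range s) (i₀ : ι) :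
    (Finset.univ.filter fun x => x ∉ (Finset.univ.erase i₀).image s ∧
      IsPrimitive u (insert x ((Finset.univ.erase i₀).image s))).card = 1 := by
  obtain ⟨t₀, ht₀⟩ := hs
  have hsinj : Function.Injective s := fun j i h => by
    by_contra hji
    exact (lt_of_le_of_lt (hmin i t₀) (htop i j t₀ ht₀ hji)).ne (by rw [h])
  set τ := (Finset.univ.erase i₀).image s with hτ
  have hcard : τ.card + 1 = Fintype.card ι := by
    rw [hτ, Finset.card_image_of_injective _ hsinj, Finset.card_erase_of_mem (Finset.mem_univ _),
      Finset.card_univ]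
    have : 0 < Fintype.card ι := Fintype.card_pos_iff.2 ⟨i₀⟩
    omega
  have hsτ : ∀ i ≠ i₀, s i ∈ τ := fun i hi =>
    Finset.mem_image_of_mem s (Finset.mem_erase.2 ⟨hi, Finset.mem_univ i⟩)
  have ht₀τ : t₀ ∉ τ := fun h => by
    obtain ⟨j, -, hj⟩ := Finset.mem_image.1 h
    exact ht₀ ⟨j, hj⟩
  obtain ⟨x₀, hx₀, hmax⟩ := τᶜ.exists_max_image (u i₀) ⟨t₀, Finset.mem_compl.2 ht₀τ⟩
  rw [Finset.card_eq_one]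
  refine ⟨x₀, ?_⟩
  ext x
  simp only [Finset.mem_filter, Finset.mem_univ, true_and, Finset.mem_singleton]
  constructor
  · rintro ⟨hx, hp⟩
    refine hu i₀ (le_antisymm (hmax x (Finset.mem_compl.2 hx)) ?_)
    obtain ⟨i, hi⟩ := hp.2 x₀
    by_cases hii : i = i₀
    · subst hii
      exact hi x (Finset.mem_insert_self x τ)
    · have h1 := hi (s i) (Finset.mem_insert_of_mem (hsτ i hii))
      have h2 := hu i (le_antisymm h1 (hmin i x₀))
      exact absurd (h2 ▸ hsτ i hii) (Finset.mem_compl.1 hx₀)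
  · rintro rfl
    have hx := Finset.mem_compl.1 hx₀
    refine ⟨hx, by rw [Finset.card_insert_of_notMem hx, hcard], fun y => ?_⟩
    by_cases hy : y ∈ τ
    · obtain ⟨j, -, rfl⟩ := Finset.mem_image.1 hy
      exact ⟨j, fun z _ => hmin j z⟩
    · refine ⟨i₀, fun z hz => ?_⟩
      rcases Finset.mem_insert.1 hz with rfl | hz
      · exact hmax y (Finset.mem_compl.2 hy)
      · obtain ⟨j, hj, rfl⟩ := Finset.mem_image.1 hz
        by_cases hyr : y ∈ range s
        · obtain ⟨l, rfl⟩ := hyr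
          have : l = i₀ := by
            by_contra h
            exact hy (hsτ l h)
          subst this
          exact hmin l _
        · exact (htop i₀ j y hyr (Finset.ne_of_mem_erase hj)).le

open Classical in
/-- **Scarf's lemma**. Let `s i` be slack elements: `s i` is `u i`-smallest, while the other `s j` are
`u i`-larger than all elements that are not slack. If `T` is coloured so that `s i` has colour `i`,
then some primitive set has all colours. -/
theorem exists_isPrimitive_image_eq_univ [Nonempty ι] {u : ι → T → ℤ}
    (hu : ∀ i, Function.Injective (u i)) {s : ι → T} (hmin : ∀ i t, u i (s i) ≤ u i t)
    (htop : ∀ i j t, t ∉ range s → j ≠ i → u i t < u i (s j)) (hs : ∃ t, t ∉ range s)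
    {c : T → ι} (hc : ∀ i, c (s i) = i) :
    ∃ σ : Finset T, IsPrimitive u σ ∧ σ.image c = Finset.univ := by
  by_contra! hcon
  obtain ⟨i₀⟩ := ‹Nonempty ι›
  have : Nonempty ι := ⟨i₀⟩
  set τ₀ := (Finset.univ.erase i₀).image s with hτ₀
  have himg : ∀ i, ((Finset.univ.erase i).image s).image c = Finset.univ.erase i := by
    intro i
    have hcs : c ∘ s = id := funext hc
    rw [Finset.image_image, hcs, Finset.image_id]
  have hτ₀c : τ₀.image c = Finset.univ.erase i₀ := himg i₀
  -- Pairs of a primitive set and a facet carrying exactly the colours `≠ i₀`, counted in two ways.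
  set Q : Finset (Finset T) := Finset.univ.filter fun σ => IsPrimitive u σ with hQ
  set D : Finset (Finset T) := Finset.univ.filter fun τ => τ.image c = Finset.univ.erase i₀ with hD
  let r : Finset T → Finset T → Prop := fun σ τ => ∃ x ∈ σ, τ = σ.erase x
  have hcount := Finset.sum_card_bipartiteAbove_eq_sum_card_bipartiteBelow r (s := Q) (t := D)
  have heven : Even (∑ σ ∈ Q, (D.bipartiteAbove r σ).card) := by
    refine Finset.even_sum _ fun σ hσ => ?_
    have hσ' : IsPrimitive u σ := (Finset.mem_filter.1 hσ).2
    have hfac : D.bipartiteAbove r σ =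
        (σ.filter fun x => (σ.erase x).image c = Finset.univ.erase i₀).image
          (fun x => σ.erase x) := by
      ext τ
      simp only [Finset.bipartiteAbove, Finset.mem_filter, Finset.mem_univ, true_and, hD,
        Finset.mem_image, r]
      constructor
      · rintro ⟨h, x, hx, rfl⟩
        exact ⟨x, ⟨hx, h⟩, rfl⟩
      · rintro ⟨x, ⟨hx, h⟩, rfl⟩
        exact ⟨h, x, hx, rfl⟩
    rw [hfac, Finset.card_image_of_injOn]
    · exact even_card_facets hσ'.1 c i₀ (hcon σ hσ')
    · intro x hx y hy hxy
      exact Finset.erase_injOn σ (Finset.mem_filter.1 (Finset.mem_coe.1 hx)).1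
        (Finset.mem_filter.1 (Finset.mem_coe.1 hy)).1 hxy
  have hfib : ∀ τ, (Q.bipartiteBelow r τ).card =
      (Finset.univ.filter fun x => x ∉ τ ∧ IsPrimitive u (insert x τ)).card := by
    intro τ
    symm
    refine Finset.card_bij (fun x _ => insert x τ) ?_ ?_ ?_
    · intro x hx
      obtain ⟨hx, hp⟩ := (Finset.mem_filter.1 hx).2
      simp only [Finset.bipartiteBelow, Finset.mem_filter, Finset.mem_univ, true_and, hQ, r]
      exact ⟨hp, x, Finset.mem_insert_self x τ, (Finset.erase_insert hx).symm⟩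
    · intro x hx y hy hxy
      have h1 := (Finset.mem_filter.1 hx).2.1
      have h2 : x ∈ insert y τ := hxy ▸ Finset.mem_insert_self x τ
      exact (Finset.mem_insert.1 h2).resolve_right h1
    · intro σ hσ
      simp only [Finset.bipartiteBelow, Finset.mem_filter, Finset.mem_univ, true_and, hQ, r] at hσ
      obtain ⟨hp, x, hx, rfl⟩ := hσ
      refine ⟨x, ?_, Finset.insert_erase hx⟩
      simp only [Finset.mem_filter, Finset.mem_univ, true_and, Finset.insert_erase hx]
      exact ⟨Finset.notMem_erase x σ, hp⟩
  have hodd : ¬ Even (∑ τ ∈ D, (Q.bipartiteBelow r τ).card) := by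
    have hmem : τ₀ ∈ D := Finset.mem_filter.2 ⟨Finset.mem_univ _, hτ₀c⟩
    rw [← Finset.add_sum_erase _ _ hmem, hfib,
      card_isPrimitive_insert_slack hu hmin htop hs i₀, Nat.even_add]
    have : Even (∑ τ ∈ D.erase τ₀, (Q.bipartiteBelow r τ).card) := by
      refine Finset.even_sum _ fun τ hτ => ?_
      rw [hfib]
      rcases Finset.eq_empty_or_nonempty
        (Finset.univ.filter fun x => x ∉ τ ∧ IsPrimitive u (insert x τ)) with h0 | ⟨x, hx⟩
      · simp [h0]
      · obtain ⟨hx, hp⟩ := (Finset.mem_filter.1 hx).2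
        obtain ⟨hne, hτD⟩ := Finset.mem_erase.1 hτ
        have hτc := (Finset.mem_filter.1 hτD).2
        rw [card_isPrimitive_insert hu hmin htop hs (fun i hi => ?_) hx hp]
        · exact even_two
        have hii : i = i₀ := by
          have h1 : τ.image c = Finset.univ.erase i := by rw [hi, himg]
          by_contra h
          have h2 : i ∈ Finset.univ.erase i₀ := Finset.mem_erase.2 ⟨h, Finset.mem_univ i⟩
          rw [← hτc, h1] at h2
          exact Finset.notMem_erase i _ h2
        exact hne (by rw [hi, hii])
    simp [this]
  exact hodd (hcount ▸ heven)

end Scarf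

/-! ### Brouwer's theorem for the standard simplex -/

section Brouwer

variable {ι : Type*} [Fintype ι] [Nonempty ι]

open Classical in
/-- Scarf's lemma on the grid of the points `a : ι → ℕ` with coordinate sum `N`: for every colouring
there is a grid point `a` such that each colour `i` occurs within bounded distance of `a`, unless
`a i` itself is bounded. The bound is the number of coordinates. -/
theorem exists_grid_point_near_colours (N : ℕ) (c : (ι → ℕ) → ι) :
    ∃ a : ι → ℕ, ∑ j, a j = N ∧ ∀ i, a i ≤ Fintype.card ι ∨
      ∃ b : ι → ℕ, ∑ j, b j = N ∧ c b = i ∧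
        ∀ j, a j ≤ b j + Fintype.card ι ∧ b j ≤ a j + Fintype.card ι := by
  obtain ⟨i₀⟩ := ‹Nonempty ι›
  have : Nonempty ι := ⟨i₀⟩
  set G : Finset (ι → ℕ) := Finset.piAntidiag Finset.univ N with hG
  have hGmem : ∀ a : ι → ℕ, a ∈ G ↔ ∑ j, a j = N := fun a => by
    simp [hG, Finset.mem_piAntidiag]
  let e := Fintype.equivFin G
  set M := Fintype.card G
  let e' := Fintype.equivFin ι
  have hle : ∀ (a : G) (i : ι), a.1 i ≤ N := fun a i => by
    have := (hGmem a.1).1 a.2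
    rw [← this]
    exact Finset.single_le_sum (f := a.1) (fun _ _ => Nat.zero_le _) (Finset.mem_univ i)
  obtain ⟨L, hL⟩ : ∃ L, L = (N + 1) * M := ⟨_, rfl⟩
  -- The `i`-th ranking is by the `i`-th coordinate, ties being broken by a fixed enumeration.
  let v : ι → G → ℕ := fun i a => a.1 i * M + e a
  let u : ι → G ⊕ ι → ℤ := fun i => Sum.elim (fun a => (v i a : ℤ))
    (fun j => if j = i then -1 else ((L + e' j : ℕ) : ℤ))
  have hvlt : ∀ i a, v i a < L := fun i a => by
    have h1 := Nat.mul_le_mul_right M (hle a i)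
    have h2 := (e a).2
    simp only [hL, v, add_mul, one_mul]
    omega
  have hvle : ∀ i (a b : G), v i a ≤ v i b → a.1 i ≤ b.1 i := fun i a b h => by
    by_contra! hlt
    have h1 := Nat.mul_le_mul_right M (Nat.succ_le_of_lt hlt)
    have h2 := (e b).2
    simp only [v] at h
    rw [Nat.succ_mul] at h1
    omega
  have hvinj : ∀ i, Function.Injective (v i) := fun i a b h => by
    have h1 := le_antisymm (hvle i a b h.le) (hvle i b a h.ge)
    simp only [v, h1] at h
    exact e.injective (Fin.ext (by omega))
  have hu : ∀ i, Function.Injective (u i) := by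
    rintro i (a | j) (b | k) h
    · simp only [u, Sum.elim_inl, Nat.cast_inj] at h
      rw [hvinj i h]
    · have := hvlt i a
      simp only [u, Sum.elim_inl, Sum.elim_inr] at h
      split_ifs at h
      omega
    · have := hvlt i b
      simp only [u, Sum.elim_inl, Sum.elim_inr] at h
      split_ifs at h
      omega
    · simp only [u, Sum.elim_inr] at h
      clear hvlt hL
      by_cases h1 : j = i <;> by_cases h2 : k = i <;> simp only [h1, h2, if_true, if_false] at h
      · rw [h1, h2]
      · omega
      · omega
      · rw [e'.injective (Fin.ext (by omega) : e' j = e' k)]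
  have hmin : ∀ i t, u i (Sum.inr i) ≤ u i t := by
    rintro i (a | j)
    · simp only [u, Sum.elim_inl, Sum.elim_inr, if_true]
      omega
    · simp only [u, Sum.elim_inr, if_true]
      split_ifs <;> omega
  have htop : ∀ i j t, t ∉ range (Sum.inr : ι → G ⊕ ι) → j ≠ i → u i t < u i (Sum.inr j) := by
    rintro i j (a | k) ht hji
    · have := hvlt i a
      simp only [u, Sum.elim_inl, Sum.elim_inr, if_neg hji]
      omega
    · exact absurd ⟨k, rfl⟩ ht
  have hGN : Pi.single i₀ N ∈ G := (hGmem _).2 (by simp)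
  obtain ⟨σ, hσ, hσc⟩ := exists_isPrimitive_image_eq_univ hu (s := Sum.inr) hmin htop
    ⟨Sum.inl ⟨_, hGN⟩, by simp⟩ (c := Sum.elim (fun a => c a.1) id) (fun i => rfl)
  -- Coordinates whose slack element is not in `σ`.
  set C : Finset ι := Finset.univ.filter fun i => Sum.inr i ∉ σ with hC
  have hCmem : ∀ i, i ∈ C ↔ Sum.inr i ∉ σ := fun i => by simp [hC]
  have hcol : ∀ i ∈ C, ∃ b : G, Sum.inl b ∈ σ ∧ c b.1 = i := by
    intro i hi
    obtain ⟨t, ht, hti⟩ := Finset.mem_image.1 (hσc ▸ Finset.mem_univ i)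
    rcases t with b | j
    · exact ⟨b, ht, hti⟩
    · simp only [Sum.elim_inr, id] at hti
      exact absurd (hti ▸ ht) ((hCmem i).1 hi)
  have hdom : ∀ y : G, ∃ i ∈ C, ∀ b : G, Sum.inl b ∈ σ → y.1 i ≤ b.1 i := by
    intro y
    obtain ⟨i, hi⟩ := hσ.2 (Sum.inl y)
    refine ⟨i, (hCmem i).2 fun h => ?_, fun b hb => ?_⟩
    · have := hi _ h
      simp only [u, Sum.elim_inl, Sum.elim_inr, if_true] at this
      omega
    · have := hi _ hb
      simp only [u, Sum.elim_inl, Nat.cast_le] at this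
      exact hvle i y b this
  obtain ⟨k, hkC, -⟩ := hdom ⟨_, hGN⟩
  obtain ⟨a, ha, -⟩ := hcol k hkC
  set A : Finset G := Finset.univ.filter fun b => Sum.inl b ∈ σ with hA
  have hAmem : ∀ b, b ∈ A ↔ Sum.inl b ∈ σ := fun b => by simp [hA]
  choose m hmA hm using fun i => A.exists_min_image (fun b => b.1 i) ⟨a, (hAmem a).2 ha⟩
  have hsum : N + 1 ≤ ∑ i ∈ C, ((m i).1 i + 1) := by
    by_contra! hlt
    -- A grid point exceeding all minima over `C` would contradict primitivity.
    let y : ι → ℕ := (fun i => if i ∈ C then (m i).1 i + 1 else 0) +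
      Pi.single k (N - ∑ i ∈ C, ((m i).1 i + 1))
    have hy : ∑ j, y j = N := by
      simp only [y, Pi.add_apply, Finset.sum_add_distrib, Finset.sum_pi_single', Finset.mem_univ,
        if_true, Finset.sum_ite_mem, Finset.univ_inter]
      rw [← Finset.sum_add_distrib]
      omega
    obtain ⟨i, hiC, hi⟩ := hdom ⟨y, (hGmem y).2 hy⟩
    have h1 := hi (m i) ((hAmem _).1 (hmA i))
    simp only [y, Pi.add_apply, if_pos hiC] at h1
    omega
  have hbound : ∀ b ∈ A, (∀ i ∈ C, (m i).1 i ≤ b.1 i ∧ b.1 i ≤ (m i).1 i + Fintype.card ι) ∧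
      ∀ i ∉ C, b.1 i ≤ Fintype.card ι := by
    intro b hb
    have hbN : ∑ j, b.1 j = N := (hGmem _).1 b.2
    have hCn : C.card ≤ Fintype.card ι := Finset.card_le_univ C
    have h0 : ∀ i, (m i).1 i ≤ b.1 i := fun i => hm i b hb
    rw [Finset.sum_add_distrib, Finset.sum_const, smul_eq_mul, mul_one] at hsum
    rw [← Finset.sum_add_sum_compl C] at hbN
    constructor
    · intro i hi
      refine ⟨h0 i, ?_⟩
      rw [← Finset.add_sum_erase _ _ hi] at hsum hbN
      have := Finset.sum_le_sum fun j (_ : j ∈ C.erase i) => h0 j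
      omega
    · intro i hi
      have h1 := Finset.sum_le_sum fun j (_ : j ∈ C) => h0 j
      have h2 := Finset.single_le_sum (f := b.1) (fun _ _ => Nat.zero_le _)
        (Finset.mem_compl.2 hi)
      omega
  have haA := (hAmem a).2 ha
  refine ⟨a.1, (hGmem _).1 a.2, fun i => ?_⟩
  by_cases hi : i ∈ C
  · obtain ⟨b, hb, hbi⟩ := hcol i hi
    have hbA := (hAmem b).2 hb
    refine Or.inr ⟨b.1, (hGmem _).1 b.2, hbi, fun j => ?_⟩
    by_cases hj : j ∈ C
    · have h1 := (hbound a haA).1 j hj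
      have h2 := (hbound b hbA).1 j hj
      omega
    · have h1 := (hbound a haA).2 j hj
      have h2 := (hbound b hbA).2 j hj
      omega
  · exact Or.inl ((hbound a haA).2 i hi)

/-- A continuous self-map of the standard simplex decreases no coordinate by more than `ε` at some
point. -/
lemma exists_forall_le_add_of_continuous {f : stdSimplex ℝ ι → stdSimplex ℝ ι} (hf : Continuous f)
    {ε : ℝ} (hε : 0 < ε) : ∃ x : stdSimplex ℝ ι, ∀ i, x.1 i ≤ (f x).1 i + ε := by
  classical
  have huc := CompactSpace.uniformContinuous_of_continuous hf
  obtain ⟨δ, hδ, hfδ⟩ := Metric.uniformContinuous_iff.1 huc (ε / 2) (half_pos hε)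
  set n := Fintype.card ι with hn
  obtain ⟨N, hN⟩ := exists_nat_gt ((n : ℝ) / min δ (ε / 2))
  have hmin : 0 < min δ (ε / 2) := lt_min hδ (half_pos hε)
  have hN0 : (0 : ℝ) < N := lt_of_le_of_lt (by positivity) hN
  have hnN : (n : ℝ) / N < min δ (ε / 2) := by
    rw [div_lt_iff₀ hmin] at hN
    rw [div_lt_iff₀ hN0]
    linarith
  have hmem : ∀ a : ι → ℕ, ∑ j, a j = N → (fun j => (a j : ℝ) / N) ∈ stdSimplex ℝ ι := by
    intro a ha
    refine ⟨fun j => by positivity, ?_⟩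
    rw [← Finset.sum_div, ← Nat.cast_sum, ha, div_self hN0.ne']
  have hcol : ∀ x : stdSimplex ℝ ι, ∃ i, x.1 i ≤ (f x).1 i := by
    intro x
    by_contra! hcon
    have h := Finset.sum_lt_sum_of_nonempty Finset.univ_nonempty
      fun i (_ : i ∈ Finset.univ) => hcon i
    rw [x.2.2, (f x).2.2] at h
    exact lt_irrefl _ h
  choose c₀ hc₀ using hcol
  let c : (ι → ℕ) → ι := fun a =>
    if h : ∑ j, a j = N then c₀ ⟨_, hmem a h⟩ else Classical.arbitrary ι
  obtain ⟨a, ha, hac⟩ := exists_grid_point_near_colours N c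
  refine ⟨⟨_, hmem a ha⟩, fun i => ?_⟩
  rcases hac i with h | ⟨b, hb, hbi, hab⟩
  · have h1 : ((a i : ℝ)) / N ≤ n / N := by gcongr
    have h2 := (f ⟨_, hmem a ha⟩).2.1 i
    have h3 := min_le_right δ (ε / 2)
    show (a i : ℝ) / N ≤ _
    linarith
  · simp only [c, dif_pos hb] at hbi
    have h1 := hc₀ ⟨_, hmem b hb⟩
    rw [hbi] at h1
    have habs : ∀ j, |(a j : ℝ) / N - b j / N| ≤ n / N := by
      intro j
      rw [← sub_div, abs_div, abs_of_pos hN0]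
      gcongr
      have h2 : (a j : ℝ) ≤ b j + n := by exact_mod_cast (hab j).1
      have h3 : (b j : ℝ) ≤ a j + n := by exact_mod_cast (hab j).2
      rw [abs_le]
      constructor <;> linarith
    have hd : dist (⟨_, hmem a ha⟩ : stdSimplex ℝ ι) ⟨_, hmem b hb⟩ < δ := by
      rw [Subtype.dist_eq]
      refine lt_of_le_of_lt ((dist_pi_le_iff (by positivity)).2 fun j => ?_)
        (hnN.trans_le (min_le_left _ _))
      exact habs j
    have h4 := hfδ hd
    rw [Subtype.dist_eq] at h4
    have h5 := (dist_le_pi_dist _ _ i).trans_lt h4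
    rw [Real.dist_eq, abs_lt] at h5
    have h6 := (abs_le.1 (habs i)).2
    have h7 := min_le_right δ (ε / 2)
    have h8 : (b i : ℝ) / N ≤ (f ⟨_, hmem b hb⟩).1 i := h1
    show (a i : ℝ) / N ≤ _
    linarith

/-- **Brouwer's fixed point theorem** for the standard simplex. -/
theorem exists_fixedPoint_stdSimplex {f : stdSimplex ℝ ι → stdSimplex ℝ ι} (hf : Continuous f) :
    ∃ x, f x = x := by
  obtain ⟨x, hx⟩ : (⋂ n : ℕ, {x : stdSimplex ℝ ι |
      ∀ i, x.1 i ≤ (f x).1 i + 1 / ((n : ℝ) + 1)}).Nonempty := by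
    have hcl : ∀ n : ℕ, IsClosed {x : stdSimplex ℝ ι |
        ∀ i, x.1 i ≤ (f x).1 i + 1 / ((n : ℝ) + 1)} := fun n => by
      simp only [ofPred_forall]
      have hev : ∀ i, Continuous fun x : stdSimplex ℝ ι => x.1 i := fun i =>
        (continuous_apply i).comp continuous_subtype_val
      exact isClosed_iInter fun i =>
        isClosed_le (hev i) (((hev i).comp hf).add continuous_const)
    refine IsCompact.nonempty_iInter_of_sequence_nonempty_isCompact_isClosed _ ?_ ?_
      (hcl 0).isCompact hcl
    · intro n x hx i
      refine (hx i).trans ?_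
      gcongr
      linarith
    · exact fun n => exists_forall_le_add_of_continuous hf (by positivity)
  have hle : ∀ i, x.1 i ≤ (f x).1 i := fun i => by
    refine le_of_forall_pos_le_add fun ε hε => ?_
    obtain ⟨n, hn⟩ := exists_nat_one_div_lt hε
    exact (mem_iInter.1 hx n i).trans (by linarith)
  refine ⟨x, Subtype.ext (funext fun i => ?_)⟩
  have := (Finset.sum_eq_sum_iff_of_le fun i (_ : i ∈ Finset.univ) => hle i).1
    (by rw [x.2.2, (f x).2.2])
  exact (this i (Finset.mem_univ i)).symm

end Brouwer

/-! ### Kakutani's theorem for the standard simplex -/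

/-- The projection of a closed set along a compact space is closed. -/
lemma isClosed_setOf_exists_of_compactSpace {X K : Type*} [TopologicalSpace X] [TopologicalSpace K]
    [CompactSpace K] {p : X → K → Prop} (h : IsClosed {q : X × K | p q.1 q.2}) :
    IsClosed {x | ∃ k, p x k} := by
  convert isClosedMap_fst_of_compactSpace _ h
  ext x
  simp

section Kakutani

variable {ι : Type*} [Fintype ι] [Nonempty ι]

/-- Averaging values of `F` with a partition of unity subordinate to a cover by balls of radius `δ`
and applying Brouwer's theorem gives an approximate fixed point of `F`. -/
lemma exists_mem_convexHull_iUnion_ball {F : stdSimplex ℝ ι → Set (ι → ℝ)}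
    (hsub : ∀ x, F x ⊆ stdSimplex ℝ ι) (hne : ∀ x, (F x).Nonempty) {δ : ℝ} (hδ : 0 < δ) :
    ∃ x : stdSimplex ℝ ι, x.1 ∈ convexHull ℝ (⋃ y ∈ Metric.ball x δ, F y) := by
  obtain ⟨t, -, htf, htc⟩ := finite_cover_balls_of_compact
    (isCompact_univ (X := stdSimplex ℝ ι)) hδ
  lift t to Finset (stdSimplex ℝ ι) using htf
  choose y hy using hne
  let φ : stdSimplex ℝ ι → stdSimplex ℝ ι → ℝ := fun z x => max 0 (δ - dist x z)
  have hφ0 : ∀ z x, 0 ≤ φ z x := fun z x => le_max_left _ _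
  have hφc : ∀ z, Continuous (φ z) := fun z => by fun_prop
  let S : stdSimplex ℝ ι → ℝ := fun x => ∑ z ∈ t, φ z x
  have hSpos : ∀ x, 0 < S x := by
    intro x
    obtain ⟨z, hz, hxz⟩ := mem_iUnion₂.1 (htc (mem_univ x))
    refine Finset.sum_pos' (fun z _ => hφ0 z x) ⟨z, hz, ?_⟩
    exact lt_max_of_lt_right (sub_pos.2 hxz)
  have hsum : ∀ x, ∑ z ∈ t, φ z x / S x = 1 := fun x => by
    rw [← Finset.sum_div, div_self (hSpos x).ne']
  let h : stdSimplex ℝ ι → ι → ℝ := fun x => ∑ z ∈ t, (φ z x / S x) • y z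
  have hmem : ∀ x, h x ∈ stdSimplex ℝ ι := fun x =>
    (convex_stdSimplex ℝ ι).sum_mem (fun z _ => div_nonneg (hφ0 z x) (hSpos x).le) (hsum x)
      fun z _ => hsub z (hy z)
  have hcont : Continuous h := by
    have hS : Continuous S := continuous_finsetSum _ fun z _ => hφc z
    exact continuous_finsetSum _ fun z _ =>
      ((hφc z).div hS fun x => (hSpos x).ne').smul continuous_const
  obtain ⟨x, hx⟩ := exists_fixedPoint_stdSimplex (f := fun x => ⟨h x, hmem x⟩)
    (hcont.subtype_mk _)
  refine ⟨x, ?_⟩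
  have hx' : x.1 = h x := (congrArg Subtype.val hx).symm
  rw [hx']
  classical
  have hfil : ∀ g : stdSimplex ℝ ι → ι → ℝ, ∑ z ∈ t.filter (fun z => dist x z < δ),
      (φ z x / S x) • g z = ∑ z ∈ t, (φ z x / S x) • g z := by
    intro g
    refine Finset.sum_filter_of_ne fun z _ hz => ?_
    by_contra hd
    refine hz ?_
    have : φ z x = 0 := max_eq_left (by linarith)
    rw [this, zero_div, zero_smul]
  have hfil1 : ∑ z ∈ t.filter (fun z => dist x z < δ), φ z x / S x = 1 := by
    rw [← hsum x]
    refine Finset.sum_filter_of_ne fun z _ hz => ?_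
    by_contra hd
    refine hz ?_
    have : φ z x = 0 := max_eq_left (by linarith)
    rw [this, zero_div]
  show ∑ z ∈ t, (φ z x / S x) • y z ∈ _
  rw [← hfil y]
  refine (convex_convexHull ℝ _).sum_mem (fun z _ => div_nonneg (hφ0 z x) (hSpos x).le) hfil1
    fun z hz => subset_convexHull ℝ _ ?_
  refine mem_iUnion₂.2 ⟨z, ?_, hy z⟩
  rw [Metric.mem_ball']
  exact (Finset.mem_filter.1 hz).2

/-- **Kakutani's fixed point theorem** for the standard simplex. -/
theorem exists_mem_of_isClosed_graph {F : stdSimplex ℝ ι → Set (ι → ℝ)}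
    (hcl : IsClosed {q : stdSimplex ℝ ι × (ι → ℝ) | q.2 ∈ F q.1})
    (hsub : ∀ x, F x ⊆ stdSimplex ℝ ι) (hne : ∀ x, (F x).Nonempty)
    (hconv : ∀ x, Convex ℝ (F x)) : ∃ x : stdSimplex ℝ ι, x.1 ∈ F x := by
  choose x hx using fun n : ℕ => exists_mem_convexHull_iUnion_ball hsub hne
    (Nat.one_div_pos_of_nat (α := ℝ) (n := n))
  obtain ⟨z, ψ, hψ, hlim⟩ := CompactSpace.tendsto_subseq x
  refine ⟨z, ?_⟩
  by_contra hz
  have hFcl : IsClosed (F z) :=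
    hcl.preimage (f := fun μ : ι → ℝ => (z, μ)) (by fun_prop)
  set ε := Metric.infDist z.1 (F z) / 2 with hε
  have hε0 : 0 < ε := half_pos ((hFcl.notMem_iff_infDist_pos (hne z)).1 hz)
  -- `F` is upper hemicontinuous at `z`, its graph being closed in a compact space.
  have husc : ∀ᶠ y in 𝓝 z, F y ⊆ Metric.thickening ε (F z) := by
    have hC : IsClosed {y : stdSimplex ℝ ι |
        ∃ μ : stdSimplex ℝ ι, μ.1 ∈ F y ∧ μ.1 ∉ Metric.thickening ε (F z)} := by
      apply isClosed_setOf_exists_of_compactSpace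
      refine IsClosed.inter (hcl.preimage
        (f := fun q : stdSimplex ℝ ι × stdSimplex ℝ ι => (q.1, q.2.1)) (by fun_prop)) ?_
      exact Metric.isOpen_thickening.isClosed_compl.preimage
        (f := fun q : stdSimplex ℝ ι × stdSimplex ℝ ι => q.2.1) (by fun_prop)
    refine Filter.mem_of_superset (hC.isOpen_compl.mem_nhds (x := z) ?_) ?_
    · rintro ⟨μ, hμ, hμ'⟩
      exact hμ' (Metric.self_subset_thickening hε0 _ hμ)
    · intro y hy μ hμ
      by_contra hcon
      exact hy ⟨⟨μ, hsub y hμ⟩, hμ, hcon⟩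
  obtain ⟨δ, hδ, hball⟩ := Metric.eventually_nhds_iff_ball.1 husc
  have hev : ∀ᶠ n in Filter.atTop, (x (ψ n)).1 ∈ Metric.thickening ε (F z) := by
    have h1 : ∀ᶠ n in Filter.atTop, dist (x (ψ n)) z < δ / 2 :=
      (tendsto_iff_dist_tendsto_zero.1 hlim).eventually_lt_const (half_pos hδ)
    have h2 : ∀ᶠ n in Filter.atTop, 1 / ((ψ n : ℝ) + 1) < δ / 2 :=
      (tendsto_one_div_add_atTop_nhds_zero_nat.comp hψ.tendsto_atTop).eventually_lt_const
        (half_pos hδ)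
    filter_upwards [h1, h2] with n hn1 hn2
    refine convexHull_min (iUnion₂_subset fun y hy => hball y ?_)
      ((hconv z).thickening ε) (hx (ψ n))
    rw [Metric.mem_ball] at hy ⊢
    have := dist_triangle y (x (ψ n)) z
    linarith
  have hzcl : z.1 ∈ Metric.cthickening ε (F z) :=
    Metric.closure_thickening_subset_cthickening ε (F z) (mem_closure_of_tendsto
      ((continuous_subtype_val.tendsto z).comp hlim) hev)
  have := (Metric.mem_thickening_iff_infDist_lt (hne z)).1
    (Metric.cthickening_subset_thickening' (δ₂ := 2 * ε) (by linarith) (by linarith) _ hzcl)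
  linarith

end Kakutani

/-! ### Topological preliminaries -/

/-- An upper hemicontinuous correspondence with closed values in a regular space has closed graph. -/
lemma UpperHemicontinuous.isClosed_setOf_mem {X Y : Type*} [TopologicalSpace X]
    [TopologicalSpace Y] [RegularSpace Y] {f : X → Set Y} (hf : UpperHemicontinuous f)
    (hcl : ∀ x, IsClosed (f x)) : IsClosed {q : X × Y | q.2 ∈ f q.1} := by
  refine isClosed_of_closure_subset fun q hq => ?_
  have := mem_closure_iff_nhdsWithin_neBot.1 hq
  have hle : 𝓝[{q : X × Y | q.2 ∈ f q.1}] q ≤ 𝓝 q := nhdsWithin_le_nhds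
  exact (hf.upperHemicontinuousAt q.1).mem_of_tendsto (hcl q.1)
    ((continuous_fst.tendsto q).mono_left hle)
    (Filter.Eventually.frequently (self_mem_nhdsWithin (s := {q : X × Y | q.2 ∈ f q.1})))
    ((continuous_snd.tendsto q).mono_left hle)

/-- Whatever the target space, in particular without a Hausdorff assumption, two linear maps from
finite-dimensional coordinate spaces agree on a closed set of pairs. -/
lemma isClosed_setOf_linearMap_eq {ι κ G : Type*} [Fintype ι] [Fintype κ] [AddCommGroup G]
    [Module ℝ G] (p : (ι → ℝ) →ₗ[ℝ] G) (q : (κ → ℝ) →ₗ[ℝ] G) :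
    IsClosed {a : (ι → ℝ) × (κ → ℝ) | p a.1 = q a.2} := by
  have h := Submodule.closed_of_finiteDimensional (LinearMap.ker (p.coprod (-q)))
  convert h using 1
  ext a
  simp [← sub_eq_add_neg, sub_eq_zero]

/-- In a locally convex space the closed convex neighbourhoods of `0` form a basis. -/
lemma exists_isClosed_convex_subset_of_mem_nhds_zero {G : Type*} [AddCommGroup G] [Module ℝ G]
    [TopologicalSpace G] [IsTopologicalAddGroup G] [ContinuousSMul ℝ G] [LocallyConvexSpace ℝ G]
    {U : Set G} (hU : U ∈ 𝓝 0) : ∃ V ∈ 𝓝 (0 : G), IsClosed V ∧ Convex ℝ V ∧ V ⊆ U := by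
  obtain ⟨C, ⟨hC, hCc⟩, hCU⟩ := (closed_nhds_basis (0 : G)).mem_iff.1 hU
  obtain ⟨V, ⟨hV, hVc⟩, hVC⟩ := (LocallyConvexSpace.convex_basis (𝕜 := ℝ) (0 : G)).mem_iff.1 hC
  exact ⟨closure V, Filter.mem_of_superset hV subset_closure, isClosed_closure, hVc.closure,
    (closure_minimal hVC hCc).trans hCU⟩

universe u v

/-- A finite product of polytopes is a linear image of a standard simplex. -/
lemma exists_linearMap_image_stdSimplex_eq_pi {I : Type u} [Finite I] {E : I → Type v}
    [∀ i, AddCommGroup (E i)] [∀ i, Module ℝ (E i)] (S : ∀ i, Set (E i))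
    (hfin : ∀ i, (S i).Finite) (hne : ∀ i, (S i).Nonempty) :
    ∃ (ι : Type (max u v)) (_ : Fintype ι) (_ : Nonempty ι) (p : (ι → ℝ) →ₗ[ℝ] ∀ i, E i),
      p '' stdSimplex ℝ ι = Set.univ.pi fun i => convexHull ℝ (S i) := by
  have hS : (Set.univ.pi S).Finite := Set.Finite.pi hfin
  let _ := hS.fintype
  refine ⟨Set.univ.pi S, hS.fintype, (Set.univ_pi_nonempty_iff.2 hne).to_subtype,
    ∑ x : Set.univ.pi S, (LinearMap.proj x).smulRight x.1, ?_⟩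
  rw [← convexHull_pi]
  exact hS.convexHull_eq_image.symm

/-- If a nonempty relatively open subset of a product of nontrivial convex sets lies in a
finite-dimensional affine subspace, then the product has finitely many factors: a short move in each
coordinate direction stays in that subspace. -/
lemma finite_of_isOpen_of_subset_affineSubspace {I : Type*} {E : I → Type*}
    [∀ i, AddCommGroup (E i)] [∀ i, Module ℝ (E i)] [∀ i, TopologicalSpace (E i)]
    [∀ i, IsTopologicalAddGroup (E i)] [∀ i, ContinuousSMul ℝ (E i)] {X : ∀ i, Set (E i)}
    (hconv : ∀ i, Convex ℝ (X i)) (hnt : ∀ i, (X i).Nontrivial) {W : Set (Set.univ.pi X)}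
    (hW : IsOpen W) (hne : W.Nonempty) {L : AffineSubspace ℝ (∀ i, E i)}
    [FiniteDimensional ℝ L.direction] (hWL : ∀ x ∈ W, x.1 ∈ L) : Finite I := by
  classical
  obtain ⟨x, hx⟩ := hne
  choose y hy hyx using fun i => (hnt i).exists_ne (x.1 i)
  have hmem : ∀ j (t : ℝ), 0 ≤ t → t ≤ 1 →
      x.1 + t • Pi.single j (y j - x.1 j) ∈ Set.univ.pi X := by
    intro j t h0 h1 i _
    by_cases hij : i = j
    · subst hij
      simp only [Pi.add_apply, Pi.smul_apply, Pi.single_eq_same]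
      exact (hconv i).add_smul_sub_mem (x.2 i (mem_univ i)) (hy i) ⟨h0, h1⟩
    · simp only [Pi.add_apply, Pi.smul_apply, Pi.single_eq_of_ne hij, smul_zero, add_zero]
      exact x.2 i (mem_univ i)
  have hdir : ∀ j, Pi.single j (y j - x.1 j) ∈ L.direction := by
    intro j
    have ht : Filter.Tendsto (fun n : ℕ => (1 : ℝ) / (n + 1)) Filter.atTop (𝓝 0) :=
      tendsto_one_div_add_atTop_nhds_zero_nat
    have hle : ∀ n : ℕ, (1 : ℝ) / (n + 1) ≤ 1 := fun n =>
      (div_le_one₀ (by positivity)).2 (by simp)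
    have hlim : Filter.Tendsto (fun n : ℕ =>
        (⟨_, hmem j (1 / ((n : ℝ) + 1)) (by positivity) (hle n)⟩ : Set.univ.pi X))
        Filter.atTop (𝓝 x) := by
      rw [tendsto_subtype_rng]
      have h := (ht.smul_const (Pi.single j (y j - x.1 j))).const_add x.1
      rwa [zero_smul, add_zero] at h
    obtain ⟨n, hn⟩ := (hlim.eventually (hW.mem_nhds hx)).exists
    have h := L.vsub_mem_direction (hWL _ hn) (hWL _ hx)
    simp only [vsub_eq_sub, add_sub_cancel_left] at h
    exact (L.direction.smul_mem_iff (by positivity)).1 h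
  have hli : LinearIndependent ℝ fun j => Pi.single (M := E) j (y j - x.1 j) :=
    (Pi.linearIndependent_single (fun j (_ : Unit) => y j - x.1 j) fun j =>
      LinearIndependent.of_subsingleton () (sub_ne_zero.2 (hyx j))).comp (fun j => ⟨j, ()⟩)
        fun i j h => congrArg Sigma.fst h
  exact (LinearIndependent.of_comp (v := fun j => (⟨_, hdir j⟩ : L.direction))
    L.direction.subtype hli).finite

/-! ### Equilibria -/

namespace AbstractEconomy

variable {I : Type u} {E : I → Type v} [∀ i, AddCommGroup (E i)]
  [∀ i, TopologicalSpace (E i)] (Γ : AbstractEconomy E)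

/-- The condition that some `b ∈ closure (Γ.B i x)` is `V`-close to `c` is closed in `(x, c)`. -/
lemma isClosed_setOf_exists_sub_mem [∀ i, IsTopologicalAddGroup (E i)] (i : I)
    (hX : IsCompact (Γ.X i))
    (hBusc : UpperHemicontinuous fun x => closure (Γ.B i x)) {V : Set (E i)} (hV : IsClosed V) :
    IsClosed {q : Γ.prodX × E i | ∃ b : Γ.X i, b ∈ closure (Γ.B i q.1) ∧ q.2 - b.1 ∈ V} := by
  have := isCompact_iff_compactSpace.1 hX
  apply isClosed_setOf_exists_of_compactSpace
  exact ((hBusc.isClosed_setOf_mem fun _ => isClosed_closure).preimage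
    (f := fun q : (Γ.prodX × E i) × Γ.X i => (q.1.1, q.2)) (by fun_prop)).inter
      (hV.preimage (f := fun q : (Γ.prodX × E i) × Γ.X i => q.1.2 - q.2.1) (by fun_prop))

variable [∀ i, Module ℝ (E i)]

/-- Weak natural quasi-concavity at the vertices `v k` of the simplex `closure (Γ.W i)` yields a
selection `∑ ν k • v k ↦ ∑ g k (ν k) • y k` of `x ↦ (A i x + V) ∩ P i x`. -/
lemma exists_selection (i : I) {V : Set (E i)}
    (hK : ∃ (m : ℕ) (S : Affine.Simplex ℝ (∀ j, E j) m),
      ((↑) '' closure (Γ.W i) : Set (∀ j, E j)) = S.closedInterior)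
    (hWNQ : WeaklyNaturallyQuasiConcaveOn (Γ.approx i V) (closure (Γ.W i))) :
    ∃ (m : ℕ) (v : Fin m → ∀ j, E j) (y : Fin m → Γ.X i) (g : Fin m → ℝ → ℝ),
      (∀ k, ContinuousOn (g k) (Icc 0 1)) ∧
      InjOn (Fintype.linearCombination ℝ v) (stdSimplex ℝ (Fin m)) ∧
      (∀ z ∈ closure (Γ.W i), ∃ ν ∈ stdSimplex ℝ (Fin m), z.1 = Fintype.linearCombination ℝ v ν) ∧
      ∀ ν ∈ stdSimplex ℝ (Fin m), (fun k => g k (ν k)) ∈ stdSimplex ℝ (Fin m) ∧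
        ∃ z ∈ closure (Γ.W i), z.1 = Fintype.linearCombination ℝ v ν ∧
          ∃ w ∈ Γ.approx i V z,
            w.1 = Fintype.linearCombination ℝ (fun k => (y k).1) fun k => g k (ν k) := by
  obtain ⟨m, S, hS⟩ := hK
  have hvert : ∀ k, ∃ x : Γ.prodX, x ∈ closure (Γ.W i) ∧ x.1 = S.points k := fun k =>
    (mem_image _ _ _).1 (hS ▸ S.point_mem_closedInterior k)
  choose x hxK hx using hvert
  have hxinj : Function.Injective x := fun k l h =>
    S.independent.injective (by rw [← hx k, ← hx l, h])
  obtain ⟨y, -, g, hg, hsel⟩ := hWNQ (m + 1) x hxinj hxK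
  have hlin : ∀ ν ∈ stdSimplex ℝ (Fin (m + 1)),
      Finset.univ.affineCombination ℝ S.points ν = Fintype.linearCombination ℝ S.points ν :=
    fun ν hν => by
      rw [Finset.affineCombination_eq_linear_combination _ _ _ hν.2,
        Fintype.linearCombination_apply]
  refine ⟨m + 1, S.points, y, g, fun k => (hg k).1, ?_, ?_, ?_⟩
  · intro ν hν ν' hν' h
    refine (affineIndependent_iff_eq_of_fintype_affineCombination_eq ℝ S.points).1 S.independent
      ν ν' hν.2 hν'.2 ?_
    rw [hlin ν hν, hlin ν' hν', h]
  · intro z hz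
    have hz' : z.1 ∈ S.closedInterior := hS ▸ mem_image_of_mem _ hz
    obtain ⟨ν, hν, h01, hνz⟩ := hz'
    have hνS : ν ∈ stdSimplex ℝ (Fin (m + 1)) := ⟨fun k => (h01 k).1, hν⟩
    exact ⟨ν, hνS, by rw [← hlin ν hνS, hνz]⟩
  · intro ν hν
    obtain ⟨hgν, z, hz, hzν, w, hw, hwν⟩ := hsel ν hν
    refine ⟨hgν, z, hz, ?_, w, hw, ?_⟩
    · rw [hzν, Fintype.linearCombination_apply]
      simp only [hx]
    · rw [hwν, Fintype.linearCombination_apply]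

variable [∀ i, IsTopologicalAddGroup (E i)] [∀ i, ContinuousSMul ℝ (E i)]

/-- For finitely many agents and closed convex neighbourhoods `V i` of `0` there is an approximate
equilibrium. It is a fixed point of the correspondence whose `i`-th component is the selection of
`x ↦ (A i x + V i) ∩ P i x` on `Γ.W i` and `closure (B i x) + V i` elsewhere. Such a fixed point
cannot lie in `Γ.W i`, as `x i ∉ P i x`. -/
theorem exists_approximate_equilibrium [Finite I]
    (hX : ∀ i, (Γ.X i).Nonempty ∧ IsCompact (Γ.X i) ∧ Convex ℝ (Γ.X i))
    (hBusc : ∀ i, UpperHemicontinuous (fun x => closure (Γ.B i x)))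
    (hBval : ∀ i x, (closure (Γ.B i x)).Nonempty ∧
      Convex ℝ ((↑) '' closure (Γ.B i x) : Set (E i)))
    (hAB : ∀ i x, Γ.A i x ⊆ Γ.B i x)
    (hWopen : ∀ i, IsOpen (Γ.W i))
    (hK : ∀ i, ∃ (m : ℕ) (S : Affine.Simplex ℝ (∀ j, E j) m),
      ((↑) '' closure (Γ.W i) : Set (∀ j, E j)) = S.closedInterior)
    {V : ∀ i, Set (E i)} (hV0 : ∀ i, V i ∈ 𝓝 0) (hVcl : ∀ i, IsClosed (V i))
    (hVconv : ∀ i, Convex ℝ (V i))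
    (hWNQ : ∀ i, WeaklyNaturallyQuasiConcaveOn (Γ.approx i (V i)) (closure (Γ.W i)))
    (hP : ∀ i, ∀ x ∈ closure (Γ.W i), Γ.coord x i ∉ Γ.P i x) :
    ∃ x : Γ.prodX, ∀ i, x ∉ Γ.W i ∧
      ∃ b : Γ.X i, b ∈ closure (Γ.B i x) ∧ x.1 i - b.1 ∈ V i := by
  choose m v y g hg hinj hsurj hsel using fun i => Γ.exists_selection i (hK i) (hWNQ i)
  -- Finitely many points `s` of `X i` such that the sets `s - V i` cover `X i`.
  have hnet : ∀ i, ∃ t : Finset (E i), (∀ s ∈ t, s ∈ Γ.X i) ∧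
      ∀ b ∈ Γ.X i, ∃ s ∈ t, s - b ∈ V i := by
    intro i
    obtain ⟨t, htX, htc⟩ := (hX i).2.1.elim_nhds_subcover (fun s => {b | s - b ∈ V i})
      fun s _ => by
        have hc : Continuous fun b : E i => s - b := by fun_prop
        exact hc.continuousAt.preimage_mem_nhds (by rw [sub_self]; exact hV0 i)
    exact ⟨t, htX, fun b hb => by simpa using htc hb⟩
  choose t htX htc using hnet
  let S : ∀ i, Set (E i) := fun i => ↑(t i) ∪ range fun k => (y i k).1
  have hSX : ∀ i, S i ⊆ Γ.X i := fun i =>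
    union_subset (htX i) (range_subset_iff.2 fun k => (y i k).2)
  have hSne : ∀ i, (S i).Nonempty := fun i => by
    obtain ⟨b, hb⟩ := (hX i).1
    obtain ⟨s, hs, -⟩ := htc i b hb
    exact ⟨s, Or.inl hs⟩
  obtain ⟨ι, _, _, p, hp⟩ := exists_linearMap_image_stdSimplex_eq_pi S
    (fun i => (t i).finite_toSet.union (finite_range _)) hSne
  have hpc : Continuous p := p.continuous_of_finiteDimensional
  have hpX : ∀ l ∈ stdSimplex ℝ ι, p l ∈ Γ.prodX := fun l hl =>
    pi_mono (fun i _ => convexHull_min (hSX i) (hX i).2.2) (hp ▸ mem_image_of_mem p hl)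
  let Q : stdSimplex ℝ ι → Γ.prodX := fun l => ⟨p l.1, hpX l.1 l.2⟩
  have hQc : Continuous Q := (hpc.comp continuous_subtype_val).subtype_mk _
  let near : ∀ i, stdSimplex ℝ ι → E i → Prop := fun i l c =>
    ∃ b : Γ.X i, b ∈ closure (Γ.B i (Q l)) ∧ c - b.1 ∈ V i
  let sel : ∀ i, stdSimplex ℝ ι → E i → Prop := fun i l c =>
    ∃ ν : stdSimplex ℝ (Fin (m i)), p l.1 = Fintype.linearCombination ℝ (v i) ν.1 ∧
      c = Fintype.linearCombination ℝ (fun k => (y i k).1) fun k => g i k (ν.1 k)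
  have hsel_spec : ∀ i l c, sel i l c → near i l c ∧ Q l ∈ closure (Γ.W i) ∧
      ∃ w ∈ Γ.P i (Q l), w.1 = c := by
    rintro i l c ⟨ν, hlν, rfl⟩
    obtain ⟨-, z, hz, hzν, w, ⟨hwA, hwP⟩, hwν⟩ := hsel i ν.1 ν.2
    have hzl : z = Q l := Subtype.ext (hzν.trans hlν.symm)
    subst hzl
    obtain ⟨-, ⟨a, ha, rfl⟩, e, he, hae⟩ := hwA
    refine ⟨⟨a, subset_closure (hAB i _ ha), ?_⟩, hz, w, hwP, hwν⟩
    rw [← hwν, ← hae]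
    simpa using he
  have hnear_conv : ∀ i l, Convex ℝ {c | near i l c} := by
    intro i l
    convert (hBval i (Q l)).2.add (hVconv i) using 1
    ext c
    simp only [near, mem_ofPred_eq, mem_add, mem_image]
    constructor
    · rintro ⟨b, hb, hbc⟩
      exact ⟨b, ⟨b, hb, rfl⟩, _, hbc, by abel⟩
    · rintro ⟨_, ⟨b, hb, rfl⟩, e, he, rfl⟩
      exact ⟨b, hb, by simpa using he⟩
  let F : stdSimplex ℝ ι → Set (ι → ℝ) := fun l =>
    {μ | μ ∈ stdSimplex ℝ ι ∧ ∀ i, (Q l ∉ Γ.W i ∧ near i l (p μ i)) ∨ sel i l (p μ i)}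
  have hFcl : IsClosed {q : stdSimplex ℝ ι × (ι → ℝ) | q.2 ∈ F q.1} := by
    have hset : {q : stdSimplex ℝ ι × (ι → ℝ) | q.2 ∈ F q.1} =
        Prod.snd ⁻¹' stdSimplex ℝ ι ∩ ⋂ i, {q : stdSimplex ℝ ι × (ι → ℝ) |
          (Q q.1 ∉ Γ.W i ∧ near i q.1 (p q.2 i)) ∨ sel i q.1 (p q.2 i)} := by
      ext q
      simp [F]
    rw [hset]
    refine ((isClosed_stdSimplex ℝ ι).preimage continuous_snd).inter ?_
    refine isClosed_iInter fun i => IsClosed.union (IsClosed.inter ?_ ?_) ?_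
    · exact (hWopen i).isClosed_compl.preimage (hQc.comp continuous_fst)
    · exact (Γ.isClosed_setOf_exists_sub_mem i (hX i).2.1 (hBusc i) (hVcl i)).preimage
        (f := fun q : stdSimplex ℝ ι × (ι → ℝ) => (Q q.1, p q.2 i)) (by fun_prop)
    · apply isClosed_setOf_exists_of_compactSpace
      refine IsClosed.inter ?_ ?_
      · exact (isClosed_setOf_linearMap_eq p (Fintype.linearCombination ℝ (v i))).preimage
          (f := fun q : (stdSimplex ℝ ι × (ι → ℝ)) × stdSimplex ℝ (Fin (m i)) =>
            (q.1.1.1, q.2.1)) (by fun_prop)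
      · have hgc : Continuous fun ν : stdSimplex ℝ (Fin (m i)) => fun k => g i k (ν.1 k) :=
          continuous_pi fun k => (hg i k).comp_continuous
            ((continuous_apply k).comp continuous_subtype_val)
            fun ν => mem_Icc_of_mem_stdSimplex ν.2 k
        exact (isClosed_setOf_linearMap_eq ((LinearMap.proj i).comp p)
          (Fintype.linearCombination ℝ fun k => (y i k).1)).preimage
          (f := fun q : (stdSimplex ℝ ι × (ι → ℝ)) × stdSimplex ℝ (Fin (m i)) =>
            (q.1.2, fun k => g i k (q.2.1 k)))
            ((continuous_snd.comp continuous_fst).prodMk (hgc.comp continuous_snd))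
  have hFne : ∀ l, (F l).Nonempty := by
    intro l
    have hex : ∀ i, ∃ c ∈ convexHull ℝ (S i), (Q l ∉ Γ.W i ∧ near i l c) ∨ sel i l c := by
      intro i
      by_cases hl : Q l ∈ Γ.W i
      · obtain ⟨ν, hν, hlν⟩ := hsurj i (Q l) (subset_closure hl)
        refine ⟨_, ?_, Or.inr ⟨⟨ν, hν⟩, hlν, rfl⟩⟩
        rw [Fintype.linearCombination_apply]
        have hgν := (hsel i ν hν).1
        exact (convex_convexHull ℝ (S i)).sum_mem (fun k _ => hgν.1 k) hgν.2
          fun k _ => subset_convexHull ℝ _ (Or.inr ⟨k, rfl⟩)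
      · obtain ⟨b, hb⟩ := (hBval i (Q l)).1
        obtain ⟨s, hs, hsb⟩ := htc i b.1 b.2
        exact ⟨s, subset_convexHull ℝ _ (Or.inl hs), Or.inl ⟨hl, b, hb, hsb⟩⟩
    choose c hcS hc using hex
    have hcp : c ∈ p '' stdSimplex ℝ ι := hp ▸ fun i _ => hcS i
    obtain ⟨μ, hμ, rfl⟩ := hcp
    exact ⟨μ, hμ, hc⟩
  have hFconv : ∀ l, Convex ℝ (F l) := by
    intro l
    have hset : F l = stdSimplex ℝ ι ∩ ⋂ i, ((LinearMap.proj i).comp p) ⁻¹'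
        {c | (Q l ∉ Γ.W i ∧ near i l c) ∨ sel i l c} := by
      ext μ
      simp [F]
    rw [hset]
    refine (convex_stdSimplex ℝ ι).inter (convex_iInter fun i => ?_)
    have hval : Convex ℝ {c | (Q l ∉ Γ.W i ∧ near i l c) ∨ sel i l c} := by
      by_cases hl : Q l ∈ Γ.W i
      · -- The barycentric coordinates of a point are unique, so that at most one value is left.
        refine Set.Subsingleton.convex ?_
        rintro _ (⟨h, -⟩ | ⟨ν, hν, rfl⟩) _ (⟨h', -⟩ | ⟨ν', hν', rfl⟩)
        · exact absurd hl h
        · exact absurd hl h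
        · exact absurd hl h'
        · rw [hinj i ν.2 ν'.2 (hν.symm.trans hν')]
      · convert hnear_conv i l using 2
        ext c
        exact ⟨fun h => h.elim And.right fun h => (hsel_spec i l c h).1, fun h => Or.inl ⟨hl, h⟩⟩
    exact hval.linear_preimage ((LinearMap.proj i).comp p)
  obtain ⟨l, -, hl⟩ := exists_mem_of_isClosed_graph hFcl (fun l μ hμ => hμ.1) hFne hFconv
  refine ⟨Q l, fun i => ?_⟩
  rcases hl i with h | h
  · exact h
  · obtain ⟨-, hcl, w, hw, hwl⟩ := hsel_spec i l _ h
    have hwc : w = Γ.coord (Q l) i := Subtype.ext hwl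
    exact absurd (hwc ▸ hw) (hP i _ hcl)

end AbstractEconomy

/-! ### Existence of an equilibrium -/

theorem theorem13 {I : Type*} {E : I → Type*}
    [∀ i, AddCommGroup (E i)] [∀ i, Module ℝ (E i)] [∀ i, TopologicalSpace (E i)]
    [∀ i, IsTopologicalAddGroup (E i)] [∀ i, ContinuousSMul ℝ (E i)]
    [∀ i, LocallyConvexSpace ℝ (E i)]
    (Γ : AbstractEconomy E)
    (hX : ∀ i, (Γ.X i).Nonempty ∧ IsCompact (Γ.X i) ∧ Convex ℝ (Γ.X i))
    (hBusc : ∀ i, UpperHemicontinuous (fun x => closure (Γ.B i x)))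
    (hBval : ∀ i x, (closure (Γ.B i x)).Nonempty ∧
      Convex ℝ ((↑) '' closure (Γ.B i x) : Set (E i)))
    (hAB : ∀ i x, Γ.A i x ⊆ Γ.B i x)
    (hWne : ∀ i, (Γ.W i).Nonempty)
    (hWopen : ∀ i, IsOpen (Γ.W i))
    (hK : ∀ i, ∃ (m : ℕ) (S : Affine.Simplex ℝ (∀ j, E j) m),
      ((↑) '' closure (Γ.W i) : Set (∀ j, E j)) = S.closedInterior)
    (hWNQ : ∀ i, ∀ V ∈ 𝓝 (0 : E i), Convex ℝ V →
      WeaklyNaturallyQuasiConcaveOn (Γ.approx i V) (closure (Γ.W i)))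
    (hP : ∀ i, ∀ x ∈ closure (Γ.W i), Γ.coord x i ∉ Γ.P i x) :
    ∃ x : Γ.prodX, Γ.IsEquilibrium x := by
  have hnt : ∀ i, (Γ.X i).Nontrivial := by
    intro i
    obtain ⟨x, a, haA, ha⟩ := hWne i
    refine ⟨a.1, a.2, _, (Γ.coord x i).2, fun h => hP i x (subset_closure ⟨a, haA, ha⟩) ?_⟩
    rwa [← show a = Γ.coord x i from Subtype.ext h]
  have hfin : Finite I := by
    rcases isEmpty_or_nonempty I with _ | ⟨⟨i⟩⟩
    · infer_instance
    obtain ⟨m, S, hS⟩ := hK i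
    have : FiniteDimensional ℝ (affineSpan ℝ (range S.points)).direction := by
      infer_instance
    exact finite_of_isOpen_of_subset_affineSubspace (fun i => (hX i).2.2) hnt (hWopen i) (hWne i)
      (L := affineSpan ℝ (range S.points)) fun x hx =>
        S.closedInterior_subset_affineSpan (hS ▸ mem_image_of_mem _ (subset_closure hx))
  have hcomp : CompactSpace Γ.prodX :=
    isCompact_iff_compactSpace.1 (isCompact_univ_pi fun i => (hX i).2.1)
  -- The approximate equilibria form a directed family of closed sets.
  let N := {V : ∀ i, Set (E i) // ∀ i, V i ∈ 𝓝 0 ∧ IsClosed (V i) ∧ Convex ℝ (V i)}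
  let D : N → Set Γ.prodX := fun V => {x | ∀ i, x ∉ Γ.W i ∧
    ∃ b : Γ.X i, b ∈ closure (Γ.B i x) ∧ x.1 i - b.1 ∈ V.1 i}
  have hDcl : ∀ V, IsClosed (D V) := by
    intro V
    simp only [D, ofPred_forall]
    refine isClosed_iInter fun i => (hWopen i).isClosed_compl.inter ?_
    exact (Γ.isClosed_setOf_exists_sub_mem i (hX i).2.1 (hBusc i) (V.2 i).2.1).preimage
      (f := fun x : Γ.prodX => (x, x.1 i))
        (continuous_id.prodMk ((continuous_apply i).comp continuous_subtype_val))
  have : Nonempty N := ⟨⟨fun _ => univ, fun _ => ⟨Filter.univ_mem, isClosed_univ, convex_univ⟩⟩⟩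
  obtain ⟨x, hx⟩ : (⋂ V, D V).Nonempty := by
    refine IsCompact.nonempty_iInter_of_directed_nonempty_isCompact_isClosed D ?_ ?_
      (fun V => (hDcl V).isCompact) hDcl
    · intro V V'
      refine ⟨⟨fun i => V.1 i ∩ V'.1 i, fun i => ⟨Filter.inter_mem (V.2 i).1 (V'.2 i).1,
        (V.2 i).2.1.inter (V'.2 i).2.1, (V.2 i).2.2.inter (V'.2 i).2.2⟩⟩, ?_, ?_⟩
      · exact fun x hx i => (hx i).imp id fun ⟨b, hb, h⟩ => ⟨b, hb, h.1⟩
      · exact fun x hx i => (hx i).imp id fun ⟨b, hb, h⟩ => ⟨b, hb, h.2⟩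
    · exact fun V => Γ.exists_approximate_equilibrium hX hBusc hBval hAB hWopen hK
        (fun i => (V.2 i).1) (fun i => (V.2 i).2.1) (fun i => (V.2 i).2.2)
        (fun i => hWNQ i _ (V.2 i).1 (V.2 i).2.2) hP
  rw [mem_iInter] at hx
  refine ⟨x, fun i => ⟨?_, not_nonempty_iff_eq_empty.1
    (hx (Classical.arbitrary N) i).1⟩⟩
  have hcl : Γ.coord x i ∈ closure (Γ.B i x) := by
    rw [← closure_closure, closure_subtype, mem_closure_iff_nhds]
    intro U hU
    have hU0 : {e : E i | x.1 i - e ∈ U} ∈ 𝓝 0 := by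
      have hc : Continuous fun e : E i => x.1 i - e := by fun_prop
      exact hc.continuousAt.preimage_mem_nhds (by rw [sub_zero]; exact hU)
    obtain ⟨V, hV0, hVcl, hVc, hVU⟩ := exists_isClosed_convex_subset_of_mem_nhds_zero hU0
    classical
    let V' : N := ⟨Function.update (fun _ => univ) i V, fun j => by
      by_cases hj : j = i
      · subst hj
        simpa using ⟨hV0, hVcl, hVc⟩
      · simpa [Function.update_of_ne hj] using convex_univ⟩
    obtain ⟨b, hb, hbV⟩ := (hx V' i).2
    have hbV' : x.1 i - b.1 ∈ V := by simpa [V'] using hbV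
    have hbU : x.1 i - (x.1 i - b.1) ∈ U := hVU hbV'
    rw [sub_sub_cancel] at hbU
    exact ⟨b.1, hbU, b, hb, rfl⟩
  exact map_mem_closure (f := fun y : Γ.X i => (x, y)) (by fun_prop) hcl fun y hy => hy
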